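/- Let $f:\mathbb{C}\to\mathbb{C}$ be a transcendental entire function, and write $f^n$ for its $n$th iterate. We say that a set $A\subset\mathbb{C}$ surrounds a set $B\subset\mathbb{C}$ if $B$ lies in a bounded connected component of $\mathbb{C}\setminus A$. Suppose that there is a sequence $(D_n)_{n\ge 0}$ of bounded, simply connected domains in $\mathbb{C}$ such that (a) $f(\partial D_n)$ surrounds $D_{n+1}$ for every $n\ge 0$, and (b) every disc centred at $0$ is contained in $D_n$ for all sufficiently large $n$. Then the set $$I^{+}(f)=\{z\in\mathbb{C} : \text{the sequence } (f^n(z))_{n\ge 1} \text{ is unbounded}\}$$ is (non-empty and) connected. -/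

import Mathlib

/-- A transcendental entire function: holomorphic on the whole plane and not a polynomial. -/
def IsTranscendentalEntire (f : ℂ → ℂ) : Prop :=
  Differentiable ℂ f ∧ ¬ ∃ p : Polynomial ℂ, ∀ z : ℂ, f z = p.eval z

/-- The set of points of the plane whose orbit under iteration of `f` is unbounded. -/
def unboundedOrbitSet (f : ℂ → ℂ) : Set ℂ :=
  {z : ℂ | ¬ Bornology.IsBounded (Set.range fun n : ℕ => f^[n] z)}

/-- `A` surrounds `B`: the set `B` lies in a bounded connected component of the complement
of `A`. -/
def Surrounds (A B : Set ℂ) : Prop :=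
  ∃ w ∈ Aᶜ, Bornology.IsBounded (connectedComponentIn Aᶜ w) ∧ B ⊆ connectedComponentIn Aᶜ w

/-! Since f(∂D_n) misses D_{n+1}, a connected set that contains a bounded orbit's starting point and
whose image leaves D_M has later images leaving D_{M+1}, D_{M+2}, ... Hence uniformly bounded
iterates on a connected set obey a bound fixed by a single orbit (`iterate_mem`). With boundary
bumping and a nested intersection, it follows that a continuum of points with bounded orbits has
uniformly bounded iterates (`inter_unboundedOrbitSet_nonempty`).

Suppose disjoint open sets separate a and b in I⁺(f), and let F be the complement of their union.
Components of F within suitable large balls are continua of bounded orbits; by the maximum principle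
they surround neither a nor b, so z - a and z - b have continuous logarithms on them. Compactness
patches these into a logarithm of (z - a)/(z - b) on F and near infinity, contradicting Eilenberg's
criterion (`not_hasLogOn_div_of_separated`). -/

open Set Metric Topology Filter Bornology

/-! ### Components and continua -/

/-- In a compact Hausdorff set, a component contained in an open set can be cut out by a compact,
relatively clopen set contained in that open set. -/
theorem exists_isCompact_inter_open_of_connectedComponentIn_subset {X : Type*}
    [TopologicalSpace X] [T2Space X] {K O : Set X} {y : X} (hK : IsCompact K) (hy : y ∈ K)
    (hO : IsOpen O) (h : connectedComponentIn K y ⊆ O) :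
    ∃ W : Set X, IsOpen W ∧ y ∈ W ∧ IsCompact (K ∩ W) ∧ K ∩ W ⊆ O := by
  have : CompactSpace K := isCompact_iff_compactSpace.1 hK
  rw [connectedComponentIn_eq_image hy, connectedComponent_eq_iInter_isClopen] at h
  have : Nonempty {s : Set K // IsClopen s ∧ (⟨y, hy⟩ : K) ∈ s} :=
    ⟨⟨univ, isClopen_univ, mem_univ _⟩⟩
  obtain ⟨⟨Z, hZ, hyZ⟩, hZO⟩ := exists_subset_nhds_of_isCompact'
    (V := fun s : {s : Set K // IsClopen s ∧ (⟨y, hy⟩ : K) ∈ s} => (s : Set K))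
    (U := (Subtype.val : K → X) ⁻¹' O)
    (fun s t => ⟨⟨s.1 ∩ t.1, s.2.1.inter t.2.1, s.2.2, t.2.2⟩, inter_subset_left,
      inter_subset_right⟩)
    (fun s => s.2.1.isClosed.isCompact) (fun s => s.2.1.isClosed)
    (fun x hx => (hO.preimage continuous_subtype_val).mem_nhds (h ⟨x, hx, rfl⟩))
  obtain ⟨W, hW, hWZ⟩ := isOpen_induced_iff.1 hZ.isOpen
  have hZK : K ∩ W = Subtype.val '' Z := by
    rw [← hWZ, Subtype.image_preimage_coe]
  refine ⟨W, hW, ?_, ?_, ?_⟩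
  · have : (⟨y, hy⟩ : K) ∈ Subtype.val ⁻¹' W := hWZ ▸ hyZ
    exact this
  · rw [hZK]
    exact hZ.isClosed.isCompact.image continuous_subtype_val
  · rw [hZK, image_subset_iff]
    exact hZO

theorem isCompact_connectedComponentIn {X : Type*} [TopologicalSpace X] {K : Set X}
    (hK : IsCompact K) (y : X) : IsCompact (connectedComponentIn K y) := by
  by_cases hy : y ∈ K
  · have : CompactSpace K := isCompact_iff_compactSpace.1 hK
    rw [connectedComponentIn_eq_image hy]
    exact isClosed_connectedComponent.isCompact.image continuous_subtype_val
  · rw [connectedComponentIn_eq_empty hy]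
    exact isCompact_empty

/-- Boundary bumping. -/
theorem IsPreconnected.exists_isCompact_isPreconnected_diff_nonempty {X : Type*}
    [TopologicalSpace X] [T2Space X] {E T O : Set X} {y : X} (hE : IsPreconnected E)
    (hK : IsCompact (E ∩ T)) (hO : IsOpen O) (hOT : O ⊆ T) (hyE : y ∈ E) (hyT : y ∈ T)
    (hET : ¬ E ⊆ T) :
    ∃ C ⊆ E ∩ T, IsCompact C ∧ IsPreconnected C ∧ y ∈ C ∧ (C \ O).Nonempty := by
  have hy : y ∈ E ∩ T := ⟨hyE, hyT⟩
  refine ⟨_root_.connectedComponentIn (E ∩ T) y, connectedComponentIn_subset _ _,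
    isCompact_connectedComponentIn hK y,
    isPreconnected_connectedComponentIn, mem_connectedComponentIn hy, ?_⟩
  by_contra hne
  rw [not_nonempty_iff_eq_empty, sdiff_eq_empty] at hne
  obtain ⟨W, hW, hyW, hQ, hQO⟩ :=
    exists_isCompact_inter_open_of_connectedComponentIn_subset hK hy hO hne
  obtain ⟨e, heE, heT⟩ := not_subset.1 hET
  -- `E ∩ T ∩ W` is compact and lies in `O`, so it would be a proper relatively clopen part of the
  -- connected `E`.
  obtain ⟨x, hxE, ⟨hxW, hxO⟩, hxQ⟩ := hE (W ∩ O) (E ∩ T ∩ W)ᶜ (hW.inter hO)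
    hQ.isClosed.isOpen_compl (fun x hx => by
      by_cases hxQ : x ∈ E ∩ T ∩ W
      · exact Or.inl ⟨hxQ.2, hQO hxQ⟩
      · exact Or.inr hxQ)
    ⟨y, hyE, hyW, hQO ⟨hy, hyW⟩⟩ ⟨e, heE, fun h => heT h.1.2⟩
  exact hxQ ⟨⟨hxE, hOT hxO⟩, hxW⟩

/-! ### Continuous logarithms and plane separation -/

/-- Continuous logarithms of `u` on `K`. -/
def HasLogOn {X : Type*} [TopologicalSpace X] (u : X → ℂ) (K : Set X) : Prop :=
  ∃ g : X → ℂ, ContinuousOn g K ∧ ∀ z ∈ K, Complex.exp (g z) = u z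

section HasLogOn

variable {X : Type*} [TopologicalSpace X] {u v : X → ℂ} {K L : Set X}

theorem HasLogOn.mono (h : HasLogOn u K) (hLK : L ⊆ K) : HasLogOn u L := by
  obtain ⟨g, hg, hgu⟩ := h
  exact ⟨g, hg.mono hLK, fun z hz => hgu z (hLK hz)⟩

theorem hasLogOn_const {c : ℂ} (hc : c ≠ 0) : HasLogOn (fun _ => c) K :=
  ⟨fun _ => Complex.log c, continuousOn_const, fun _ _ => Complex.exp_log hc⟩

theorem HasLogOn.div (hu : HasLogOn u K) (hv : HasLogOn v K) :
    HasLogOn (fun z => u z / v z) K := by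
  obtain ⟨g, hg, hgu⟩ := hu
  obtain ⟨k, hk, hkv⟩ := hv
  exact ⟨fun z => g z - k z, hg.sub hk, fun z hz => by
    rw [Complex.exp_sub, hgu z hz, hkv z hz]⟩

theorem HasLogOn.union (hK : HasLogOn u K) (hL : HasLogOn u L) (hKc : IsClosed K)
    (hLc : IsClosed L) (hd : Disjoint K L) : HasLogOn u (K ∪ L) := by
  classical
  obtain ⟨g, hg, hgu⟩ := hK
  obtain ⟨k, hk, hku⟩ := hL
  have hgK : EqOn (K.piecewise g k) g K := K.piecewise_eqOn g k
  have hkL : EqOn (K.piecewise g k) k L := fun z hz =>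
    K.piecewise_eq_of_notMem g k (fun h => hd.le_bot ⟨h, hz⟩)
  refine ⟨K.piecewise g k, (hg.congr hgK).union_of_isClosed (hk.congr hkL) hKc hLc, ?_⟩
  rintro z (hz | hz)
  · rw [hgK hz, hgu z hz]
  · rw [hkL hz, hku z hz]

theorem HasLogOn.of_div_mem_slitPlane (h : HasLogOn u K) (hu : ContinuousOn u K)
    (hv : ContinuousOn v K) (huv : ∀ z ∈ K, v z / u z ∈ Complex.slitPlane) : HasLogOn v K := by
  obtain ⟨g, hg, hgu⟩ := h
  have h0 : ∀ z ∈ K, u z ≠ 0 := fun z hz => by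
    rw [← hgu z hz]; exact Complex.exp_ne_zero _
  refine ⟨fun z => g z + Complex.log (v z / u z), hg.add ((hv.div hu h0).clog huv), ?_⟩
  intro z hz
  rw [Complex.exp_add, hgu z hz, Complex.exp_log (Complex.slitPlane_ne_zero (huv z hz)),
    mul_div_cancel₀ _ (h0 z hz)]

theorem div_mem_slitPlane_of_norm_sub_lt {a b : ℂ} (h : ‖a - b‖ < ‖b‖) :
    a / b ∈ Complex.slitPlane := by
  have hb : b ≠ 0 := by
    rintro rfl
    simp at h
    exact absurd h (not_lt.2 (norm_nonneg _))
  have : a / b = 1 + (a - b) / b := by field_simp; ring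
  rw [this]
  apply Complex.mem_slitPlane_of_norm_lt_one
  rw [norm_div, div_lt_one (norm_pos_iff.2 hb)]
  exact h

theorem HasLogOn.of_norm_sub_lt (h : HasLogOn u K) (hu : ContinuousOn u K)
    (hv : ContinuousOn v K) (huv : ∀ z ∈ K, ‖v z - u z‖ < ‖u z‖) : HasLogOn v K :=
  h.of_div_mem_slitPlane hu hv fun z hz => div_mem_slitPlane_of_norm_sub_lt (huv z hz)

theorem HasLogOn.of_norm_sub_lt' (h : HasLogOn u K) (hu : ContinuousOn u K)
    (hv : ContinuousOn v K) (huv : ∀ z ∈ K, ‖v z - u z‖ < ‖v z‖) : HasLogOn v K := by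
  obtain ⟨g, hg, hgu⟩ := h
  have h0 : ∀ z ∈ K, v z ≠ 0 := fun z hz =>
    norm_pos_iff.1 ((norm_nonneg _).trans_lt (huv z hz))
  have hs : ∀ z ∈ K, u z / v z ∈ Complex.slitPlane := fun z hz =>
    div_mem_slitPlane_of_norm_sub_lt (by rw [norm_sub_rev]; exact huv z hz)
  refine ⟨fun z => g z - Complex.log (u z / v z), hg.sub ((hu.div hv h0).clog hs), ?_⟩
  intro z hz
  have hu0 : u z ≠ 0 := by rw [← hgu z hz]; exact Complex.exp_ne_zero _
  rw [Complex.exp_sub, hgu z hz, Complex.exp_log (Complex.slitPlane_ne_zero (hs z hz))]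
  have := h0 z hz
  field_simp

/-- A continuous logarithm on a closed set extends to a neighbourhood. -/
theorem HasLogOn.exists_isOpen_superset [NormalSpace X] (h : HasLogOn u K) (hu : Continuous u)
    (hK : IsClosed K) : ∃ O, IsOpen O ∧ K ⊆ O ∧ HasLogOn u O := by
  obtain ⟨g, hg, hgu⟩ := h
  obtain ⟨G, hG⟩ := ContinuousMap.exists_restrict_eq hK ⟨K.domRestrict g, hg.domRestrict⟩
  have hGg : ∀ z ∈ K, G z = g z := fun z hz => congrArg (fun k => k ⟨z, hz⟩) hG
  refine ⟨{z | ‖u z - Complex.exp (G z)‖ < ‖Complex.exp (G z)‖},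
    isOpen_lt (by fun_prop) (by fun_prop), fun z hz => ?_, ?_⟩
  · rw [mem_ofPred_eq, hGg z hz, hgu z hz, sub_self, norm_zero, ← hgu z hz]
    exact norm_pos_iff.2 (Complex.exp_ne_zero _)
  · exact HasLogOn.of_norm_sub_lt (u := fun z => Complex.exp (G z))
      ⟨G, G.continuous.continuousOn, fun _ _ => rfl⟩ (by fun_prop) hu.continuousOn fun z hz => hz

end HasLogOn

/-- Along one turn, a logarithm minus `i t + log R` takes values in `2πiℤ`, yet its imaginary part
drops by `2π`; the intermediate value theorem gives a forbidden half-way value. -/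
theorem not_hasLogOn_id_sphere {R : ℝ} (hR : 0 < R) : ¬ HasLogOn (fun z : ℂ => z) (sphere 0 R) := by
  rintro ⟨g, hg, hgz⟩
  set p : ℝ → ℂ := fun t => R * Complex.exp (t * Complex.I) with hp
  have hps : ∀ t, p t ∈ sphere (0 : ℂ) R := fun t => by
    simp [hp, Complex.norm_exp_ofReal_mul_I, abs_of_pos hR]
  set k : ℝ → ℂ := fun t => g (p t) - t * Complex.I - Real.log R with hk
  have hpc : Continuous p := by fun_prop
  have hkc : Continuous k := by
    exact ((hg.comp_continuous hpc hps).sub (by fun_prop)).sub continuous_const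
  have hint : ∀ t, ∃ n : ℤ, (k t).im = n * (2 * Real.pi) := fun t => by
    have : Complex.exp (k t) = 1 := by
      have hR' : (R : ℂ) ≠ 0 := by exact_mod_cast hR.ne'
      rw [hk]
      simp only
      rw [Complex.exp_sub, Complex.exp_sub, hgz _ (hps t), ← Complex.ofReal_exp,
        Real.exp_log hR, hp]
      field_simp
    obtain ⟨n, hn⟩ := Complex.exp_eq_one_iff.1 this
    exact ⟨n, by rw [hn]; simp⟩
  have hend : (k (2 * Real.pi)).im = (k 0).im - 2 * Real.pi := by
    have : p (2 * Real.pi) = p 0 := by simp [hp]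
    simp only [hk, this]
    simp
  have hpi := Real.pi_pos
  obtain ⟨t, -, ht⟩ := intermediate_value_Icc' (by positivity : (0 : ℝ) ≤ 2 * Real.pi)
    (Complex.continuous_im.comp hkc).continuousOn
    (show (k 0).im - Real.pi ∈ _ from ⟨by simp only [Function.comp, hend]; linarith,
      by simp only [Function.comp]; linarith⟩)
  obtain ⟨n, hn⟩ := hint t
  obtain ⟨m, hm⟩ := hint 0
  simp only [Function.comp] at ht
  have : ((2 * n : ℤ) : ℝ) = ((2 * m - 1 : ℤ) : ℝ) := by
    push_cast
    have := hn.symm.trans (ht.trans (by rw [hm]))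
    nlinarith
  have := Int.cast_injective this
  omega

/-- A nonvanishing continuous function on the plane has a logarithm on each circle. -/
theorem hasLogOn_sphere_of_continuous {ψ : ℂ → ℂ} (hψ : Continuous ψ) (h0 : ∀ z, ψ z ≠ 0)
    (R : ℝ) : HasLogOn ψ (sphere 0 R) := by
  have hc : IsCompact (Icc (0 : ℝ) 1 ×ˢ sphere (0 : ℂ) R) := isCompact_Icc.prod (isCompact_sphere 0 R)
  -- Contract the circle to 0, where `H` is constant; uniform continuity carries the logarithm
  -- outwards through finitely many radii.
  set H : ℝ × ℂ → ℂ := fun q => ψ (q.1 * q.2) with hH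
  have hHc : Continuous H := by fun_prop
  obtain ⟨m, hm, hmH⟩ : ∃ m > 0, ∀ q ∈ Icc (0 : ℝ) 1 ×ˢ sphere (0 : ℂ) R, m ≤ ‖H q‖ := by
    rcases (Icc (0 : ℝ) 1 ×ˢ sphere (0 : ℂ) R).eq_empty_or_nonempty with he | hne
    · exact ⟨1, one_pos, by simp [he]⟩
    · obtain ⟨q, -, hq⟩ := hc.exists_isMinOn hne hHc.norm.continuousOn
      exact ⟨‖H q‖, norm_pos_iff.2 (h0 _), fun x hx => hq hx⟩
  obtain ⟨δ, hδ, hδH⟩ := Metric.uniformContinuousOn_iff.1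
    (hc.uniformContinuousOn_of_continuous hHc.continuousOn) m hm
  obtain ⟨N, hN⟩ := exists_nat_one_div_lt hδ
  have key : ∀ n : ℕ, n ≤ N + 1 →
      HasLogOn (fun z => H ((n : ℝ) / (N + 1), z)) (sphere 0 R) := by
    have hN0 : (0 : ℝ) < N + 1 := by positivity
    intro n
    induction n with
    | zero => intro _; simpa [hH] using hasLogOn_const (h0 0)
    | succ n ih =>
      intro hn
      have hmem : ∀ j : ℕ, j ≤ N + 1 → (j : ℝ) / (N + 1) ∈ Icc (0 : ℝ) 1 := fun j hj =>
        ⟨by positivity, by rw [div_le_one hN0]; exact_mod_cast hj⟩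
      refine (ih (by omega)).of_norm_sub_lt (by fun_prop) (by fun_prop) fun z hz => ?_
      refine lt_of_lt_of_le ?_ (hmH _ ⟨hmem n (by omega), hz⟩)
      rw [← dist_eq_norm]
      refine hδH _ ⟨hmem _ hn, hz⟩ _ ⟨hmem n (by omega), hz⟩ ?_
      rw [Prod.dist_eq, dist_self, max_eq_left dist_nonneg, Real.dist_eq, ← sub_div]
      push_cast
      rw [add_sub_cancel_left, abs_of_pos (by positivity)]
      exact hN
  have := key (N + 1) le_rfl
  have h1 : ((N + 1 : ℕ) : ℝ) / (N + 1) = 1 := by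
    push_cast; exact div_self (by positivity)
  simpa only [h1, hH, Complex.ofReal_one, one_mul] using this

/-- If `(z - a) / (z - b)` has a continuous logarithm on a closed set containing a neighbourhood
of infinity and the complement of `U ∪ V`, then `U` and `V` do not separate `a` from `b`. -/
theorem not_hasLogOn_div_of_separated {U V E : Set ℂ} {a b : ℂ} {R : ℝ} (hU : IsOpen U)
    (hV : IsOpen V) (hUV : Disjoint U V) (ha : a ∈ U) (hb : b ∈ V) (hE : IsClosed E)
    (hUVE : (U ∪ V)ᶜ ⊆ E) (hRE : (ball 0 R)ᶜ ⊆ E) :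
    ¬ HasLogOn (fun z => (z - a) / (z - b)) E := by
  classical
  rintro ⟨g, hg, hgu⟩
  obtain ⟨G, hG⟩ := ContinuousMap.exists_restrict_eq hE ⟨E.domRestrict g, hg.domRestrict⟩
  have hGg : ∀ z ∈ E, Complex.exp (G z) = (z - a) / (z - b) := fun z hz => by
    refine Eq.trans ?_ (hgu z hz)
    exact congrArg (fun k => Complex.exp (k ⟨z, hz⟩)) hG
  have hGE : ∀ z ∈ E, (z - b) * Complex.exp (G z) = z - a := fun z hz => by
    have h0 : z - b ≠ 0 := fun h => by
      have := hGg z hz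
      rw [h, div_zero] at this
      exact Complex.exp_ne_zero _ this
    rw [hGg z hz, mul_div_cancel₀ _ h0]
  -- The formulas agree on `E`, which contains the frontier of `U`, and each is used only away from
  -- its zero, as `b ∉ U` and `a ∈ U`.
  set ψ : ℂ → ℂ := fun z => if z ∈ U then (z - b) * Complex.exp (G z) else z - a with hψ
  have hψE : ∀ z ∈ E, ψ z = z - a := fun z hz => by
    simp only [hψ]
    split_ifs
    · exact hGE z hz
    · rfl
  have hψc : Continuous ψ := by
    refine Continuous.if (fun z hz => hGE z (hUVE ?_)) (by fun_prop) (by fun_prop)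
    rintro (h | h)
    · exact (hU.frontier_eq ▸ hz : z ∈ closure U \ U).2 h
    · exact (hUV.closure_left hV).le_bot ⟨frontier_subset_closure hz, h⟩
  have hψ0 : ∀ z, ψ z ≠ 0 := fun z => by
    simp only [hψ]
    split_ifs with h
    · refine mul_ne_zero (sub_ne_zero.2 ?_) (Complex.exp_ne_zero _)
      rintro rfl
      exact hUV.le_bot ⟨h, hb⟩
    · refine sub_ne_zero.2 ?_
      rintro rfl
      exact h ha
  set S := max R (‖a‖ + 1) with hS
  have hS0 : 0 < S := lt_of_lt_of_le (by positivity) (le_max_right _ _)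
  refine not_hasLogOn_id_sphere hS0 ((hasLogOn_sphere_of_continuous hψc hψ0 S).of_norm_sub_lt'
    hψc.continuousOn continuousOn_id fun z hz => ?_)
  have hzS : ‖z‖ = S := by simpa using hz
  have hzE : z ∈ E := hRE (by simp [hzS, hS])
  rw [hψE z hzE, sub_sub_cancel, hzS]
  exact lt_of_lt_of_le (by linarith) (le_max_right _ _)

/-- A point in an unbounded component of the complement of a compact set `K` has a continuous
logarithm of `z - a` on `K`. -/
theorem hasLogOn_sub_of_not_isBounded {K : Set ℂ} {a : ℂ} (hK : IsCompact K)
    (ha : ¬ IsBounded (connectedComponentIn Kᶜ a)) : HasLogOn (fun z => z - a) K := by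
  rcases K.eq_empty_or_nonempty with rfl | hne
  · exact ⟨fun _ => 0, continuousOn_empty _, by simp⟩
  obtain ⟨B, hB⟩ := hK.isBounded.exists_norm_le
  -- Relative to `Kᶜ` this set is clopen, and it contains every point of norm above `B`.
  set T : Set ℂ := {c | HasLogOn (fun z => z - c) K}
  have hcl : ∀ c ∉ K, ∃ δ > 0, ∀ c' ∈ ball c δ, (c ∈ T ↔ c' ∈ T) := fun c hc => by
    refine ⟨infDist c K, (hK.isClosed.notMem_iff_infDist_pos hne).1 hc, fun c' hc' => ?_⟩
    have : ∀ z ∈ K, ‖c' - c‖ < ‖z - c‖ := fun z hz => by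
      rw [← dist_eq_norm, ← dist_eq_norm, dist_comm z]
      exact lt_of_lt_of_le hc' (infDist_le_dist_of_mem hz)
    constructor
    · intro h
      refine h.of_norm_sub_lt (by fun_prop) (by fun_prop) fun z hz => ?_
      rw [sub_sub_sub_cancel_left, norm_sub_rev]
      exact this z hz
    · intro h
      refine h.of_norm_sub_lt' (by fun_prop) (by fun_prop) fun z hz => ?_
      rw [sub_sub_sub_cancel_left]
      exact this z hz
  have hKo : IsOpen Kᶜ := hK.isClosed.isOpen_compl
  have hT : IsOpen (Kᶜ ∩ T) := by
    rw [isOpen_iff_mem_nhds]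
    rintro c ⟨hc, hcT⟩
    obtain ⟨δ, hδ, h⟩ := hcl c hc
    exact inter_mem (hKo.mem_nhds hc) (mem_of_superset (ball_mem_nhds c hδ)
      fun x hx => (h x hx).1 hcT)
  have hT' : IsOpen (Kᶜ ∩ Tᶜ) := by
    rw [isOpen_iff_mem_nhds]
    rintro c ⟨hc, hcT⟩
    obtain ⟨δ, hδ, h⟩ := hcl c hc
    exact inter_mem (hKo.mem_nhds hc) (mem_of_superset (ball_mem_nhds c hδ)
      fun x hx hxT => hcT ((h x hx).2 hxT))
  obtain ⟨c, hc, hcB⟩ : ∃ c ∈ connectedComponentIn Kᶜ a, B < ‖c‖ := by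
    by_contra! h
    exact ha (isBounded_iff_forall_norm_le.2 ⟨B, h⟩)
  have hB0 : 0 ≤ B := (norm_nonneg _).trans (hB _ hne.some_mem)
  have hcT : c ∈ T := by
    have hc0 : -c ≠ 0 := by
      rw [neg_ne_zero, ← norm_pos_iff]
      linarith
    refine (hasLogOn_const hc0).of_norm_sub_lt (by fun_prop) (by fun_prop) fun z hz => ?_
    rw [sub_neg_eq_add, sub_add_cancel, norm_neg]
    exact (hB z hz).trans_lt hcB
  have haK : a ∈ Kᶜ := by
    by_contra h
    rw [connectedComponentIn_eq_empty h] at hc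
    exact hc
  have hsub := isPreconnected_connectedComponentIn.subset_left_of_subset_union hT hT'
    (disjoint_left.2 fun x hx hx' => hx'.2 hx.2)
    (fun x hx => by
      have := connectedComponentIn_subset Kᶜ a hx
      by_cases h : x ∈ T
      · exact Or.inl ⟨this, h⟩
      · exact Or.inr ⟨this, h⟩)
    ⟨c, hc, connectedComponentIn_subset _ _ hc, hcT⟩
  exact (hsub (mem_connectedComponentIn haK)).2

/-! ### Bounded iterates and expanding exhaustions -/

/-- The iterates of `f` are uniformly bounded on `C`. -/
def HasBoundedIteratesOn (f : ℂ → ℂ) (C : Set ℂ) : Prop :=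
  ∃ B : ℝ, ∀ z ∈ C, ∀ n : ℕ, ‖f^[n] z‖ ≤ B

theorem notMem_unboundedOrbitSet_iff {f : ℂ → ℂ} {z : ℂ} :
    z ∉ unboundedOrbitSet f ↔ ∃ B : ℝ, ∀ n : ℕ, ‖f^[n] z‖ ≤ B := by
  rw [unboundedOrbitSet, mem_ofPred_eq, not_not, isBounded_iff_forall_norm_le]
  simp only [forall_mem_range]

/-- Bounded open sets exhausting the plane such that the image of the boundary of each of them
avoids the next one. -/
structure IsExpandingExhaustion (f : ℂ → ℂ) (D : ℕ → Set ℂ) : Prop where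
  isOpen : ∀ n, IsOpen (D n)
  isBounded : ∀ n, IsBounded (D n)
  disjoint : ∀ n, Disjoint (f '' frontier (D n)) (D (n + 1))
  eventually_subset : ∀ r : ℝ, 0 < r → ∃ N : ℕ, ∀ n : ℕ, N ≤ n → ball (0 : ℂ) r ⊆ D n

/-- A preconnected set meeting an open set `D` but not contained in it meets its frontier. -/
theorem IsPreconnected.inter_frontier_nonempty {X : Type*} [TopologicalSpace X] {C D : Set X}
    (hC : IsPreconnected C) (hD : IsOpen D) (h : (C ∩ D).Nonempty) (h' : ¬ C ⊆ D) :
    (C ∩ frontier D).Nonempty := by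
  by_contra hne
  refine h' (hC.subset_left_of_subset_union hD isClosed_closure.isOpen_compl
    (disjoint_compl_right.mono_left subset_closure) (fun x hx => ?_) h)
  by_cases hxD : x ∈ D
  · exact Or.inl hxD
  · exact Or.inr fun hcl => hne ⟨x, hx, by rw [hD.frontier_eq]; exact ⟨hcl, hxD⟩⟩

namespace IsExpandingExhaustion

variable {f : ℂ → ℂ} {D : ℕ → Set ℂ}

theorem exists_forall_mem (hD : IsExpandingExhaustion f D) (k : ℝ) :
    ∃ M : ℕ, ∀ n, M ≤ n → ∀ z : ℂ, ‖z‖ ≤ k → z ∈ D n := by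
  obtain ⟨M, hM⟩ := hD.eventually_subset (|k| + 1) (by positivity)
  refine ⟨M, fun n hn z hz => hM n hn ?_⟩
  rw [mem_ball_zero_iff]
  linarith [le_abs_self k]

/-- The orbit of `x` keeps a point of the image in `D (M + i)`; an image that also leaves this set
meets its frontier, which `f` sends outside `D (M + i + 1)`. -/
theorem iterate_image_not_subset (hD : IsExpandingExhaustion f D) (hf : Continuous f)
    {C : Set ℂ} (hC : IsPreconnected C) {x : ℂ} (hx : x ∈ C) {M : ℕ}
    (hM : ∀ n, M ≤ n → ∀ i : ℕ, f^[i] x ∈ D n) {n : ℕ} (h : ¬ f^[n] '' C ⊆ D M) (i : ℕ) :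
    ¬ f^[n + i] '' C ⊆ D (M + i) := by
  induction i with
  | zero => exact h
  | succ i ih =>
    intro hsub
    obtain ⟨w, ⟨z, hz, rfl⟩, hwD⟩ := (hC.image _ (hf.iterate (n + i)).continuousOn).inter_frontier_nonempty
      (hD.isOpen (M + i)) ⟨_, mem_image_of_mem _ hx, hM _ (by omega) _⟩ ih
    refine (hD.disjoint (M + i)).le_bot ⟨mem_image_of_mem f hwD, hsub ⟨z, hz, ?_⟩⟩
    rw [← add_assoc, Function.iterate_succ_apply']

/-- If the iterates are uniformly bounded on a connected set, then the bound depends on a single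
orbit only. -/
theorem iterate_mem (hD : IsExpandingExhaustion f D) (hf : Continuous f)
    {C : Set ℂ} (hC : IsPreconnected C) {x : ℂ} (hx : x ∈ C) {M : ℕ}
    (hM : ∀ n, M ≤ n → ∀ i : ℕ, f^[i] x ∈ D n) (hb : HasBoundedIteratesOn f C)
    {z : ℂ} (hz : z ∈ C) (n : ℕ) : f^[n] z ∈ D M := by
  by_contra h
  obtain ⟨B, hB⟩ := hb
  obtain ⟨N, hN⟩ := hD.exists_forall_mem B
  -- Escape persists for `N` more steps, yet `D (M + N)` contains the closed ball of radius `B`.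
  refine hD.iterate_image_not_subset hf hC hx hM (n := n)
    (fun hs => h (hs (mem_image_of_mem _ hz))) N ?_
  rintro _ ⟨w, hw, rfl⟩
  exact hN _ (by omega) _ (hB w hw _)

theorem hasBoundedIteratesOn_of_forall_mem (hD : IsExpandingExhaustion f D) {C : Set ℂ} {M : ℕ}
    (h : ∀ z ∈ C, ∀ n : ℕ, f^[n] z ∈ D M) : HasBoundedIteratesOn f C := by
  obtain ⟨B, hB⟩ := (hD.isBounded M).exists_norm_le
  exact ⟨B, fun z hz n => hB _ (h z hz n)⟩

/-- Otherwise every subcontinuum avoiding the set `P` of orbits bounded by `k` has uniformly bounded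
iterates. Such continua through `y`, reaching ever closer to `P`, share a bound set by `y` alone.
The closure of their union meets `P`, so `iterate_mem` from there puts the orbit of `y` in a `D M`
independent of `y`. -/
theorem exists_subset_lt_norm_iterate (hD : IsExpandingExhaustion f D) (hf : Continuous f)
    {Γ : Set ℂ} (hΓ : IsCompact Γ) (hΓc : IsPreconnected Γ) (hb : ¬ HasBoundedIteratesOn f Γ)
    (k : ℝ) : ∃ Γ' ⊆ Γ, IsCompact Γ' ∧ IsPreconnected Γ' ∧ ¬ HasBoundedIteratesOn f Γ' ∧
      ∀ z ∈ Γ', ∃ n : ℕ, k < ‖f^[n] z‖ := by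
  by_contra! hcon
  replace hcon : ∀ C ⊆ Γ, IsCompact C → IsPreconnected C → (∀ z ∈ C, ∃ n : ℕ, k < ‖f^[n] z‖) →
      HasBoundedIteratesOn f C := by
    intro C h1 h2 h3 h4
    by_contra h5
    obtain ⟨z, hz, h6⟩ := hcon C h1 h2 h3 h5
    obtain ⟨n, hn⟩ := h4 z hz
    exact absurd hn (not_lt.2 (h6 n))
  set P : Set ℂ := {z ∈ Γ | ∀ n : ℕ, ‖f^[n] z‖ ≤ k} with hP
  have hPc : IsClosed P := by
    have : P = Γ ∩ ⋂ n : ℕ, {z | ‖f^[n] z‖ ≤ k} := by ext z; simp [hP]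
    rw [this]
    exact hΓ.isClosed.inter (isClosed_iInter fun n =>
      isClosed_le (hf.iterate n).norm continuous_const)
  have hPΓ : P ⊆ Γ := fun z hz => hz.1
  have hlt : ∀ z ∈ Γ, z ∉ P → ∃ n : ℕ, k < ‖f^[n] z‖ := fun z hz hzP => by
    by_contra! h
    exact hzP ⟨hz, h⟩
  have hPne : P.Nonempty := by
    by_contra he
    exact hb (hcon Γ subset_rfl hΓ hΓc fun z hz => hlt z hz fun h => he ⟨z, h⟩)
  obtain ⟨M, hM⟩ := hD.exists_forall_mem k
  refine hb (hD.hasBoundedIteratesOn_of_forall_mem (M := M) fun y hy n => ?_)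
  by_cases hyP : y ∈ P
  · exact hM M le_rfl _ (hyP.2 n)
  obtain ⟨m, hm⟩ := hcon {y} (singleton_subset_iff.2 hy) isCompact_singleton
    isPreconnected_singleton (by simpa using hlt y hy hyP)
  obtain ⟨M', hM'⟩ := hD.exists_forall_mem m
  set d := infDist y P
  have hd : 0 < d := (hPc.notMem_iff_infDist_pos hPne).1 hyP
  have hcont : Continuous fun z => infDist z P := continuous_infDist_pt P
  have hpiece : ∀ ε : Ioc 0 d, ∃ C ⊆ Γ, IsPreconnected C ∧ y ∈ C ∧
      (∀ z ∈ C, ∀ n : ℕ, f^[n] z ∈ D M') ∧ ∃ w ∈ C, infDist w P ≤ ε := by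
    rintro ⟨ε, hε, hεd⟩
    obtain ⟨C, hCT, hC, hCp, hyC, w, hwC, hw⟩ :=
      hΓc.exists_isCompact_isPreconnected_diff_nonempty (T := {z | ε ≤ infDist z P})
        (O := {z | ε < infDist z P}) (y := y)
        (hΓ.inter_right (isClosed_le continuous_const hcont))
        (isOpen_lt continuous_const hcont) (fun z (hz : ε < infDist z P) => hz.le) hy hεd
        (fun h => by
          have : ε ≤ infDist hPne.some P := h (hPΓ hPne.some_mem)
          rw [infDist_zero_of_mem hPne.some_mem] at this
          linarith)
    refine ⟨C, fun z hz => (hCT hz).1, hCp, hyC, ?_, w, hwC, not_lt.1 hw⟩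
    refine fun z hz n => hD.iterate_mem hf hCp hyC
      (fun n hn i => hM' n hn _ (hm y rfl i)) (hcon C (fun z hz => (hCT hz).1) hC hCp
        fun z hz => hlt z (hCT hz).1 fun hzP => ?_) hz n
    have : ε ≤ infDist z P := (hCT hz).2
    rw [infDist_zero_of_mem hzP] at this
    linarith
  choose C hCΓ hCp hyC hCD w hwC hw using hpiece
  set K := closure (⋃ ε, C ε) with hK
  have hKΓ : K ⊆ Γ := closure_minimal (iUnion_subset hCΓ) hΓ.isClosed
  have hKc : IsCompact K := hΓ.of_isClosed_subset isClosed_closure hKΓ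
  have hyK : y ∈ K := subset_closure (mem_iUnion.2 ⟨⟨d, hd, le_rfl⟩, hyC _⟩)
  have hKp : IsPreconnected K := (isPreconnected_iUnion ⟨y, mem_iInter.2 hyC⟩ hCp).closure
  have hKb : HasBoundedIteratesOn f K := by
    obtain ⟨B, hB⟩ := (hD.isBounded M').exists_norm_le
    refine ⟨B, fun z hz n => ?_⟩
    refine closure_minimal (s := ⋃ ε, C ε) (t := {z | ‖f^[n] z‖ ≤ B}) ?_
      (isClosed_le (hf.iterate n).norm continuous_const) hz
    exact iUnion_subset fun ε z hz => hB _ (hCD ε z hz n)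
  -- The pieces come arbitrarily near `P`, so the minimal distance is 0 and is attained in the
  -- closed set `P`.
  obtain ⟨x, hxK, hxmin⟩ := hKc.exists_isMinOn ⟨y, hyK⟩ hcont.continuousOn
  have hxP : x ∈ P := by
    by_contra hxP
    have hx : 0 < infDist x P := (hPc.notMem_iff_infDist_pos hPne).1 hxP
    let ε : Ioc 0 d := ⟨min d (infDist x P / 2), lt_min hd (by linarith), min_le_left _ _⟩
    have h1 : infDist x P ≤ infDist (w ε) P := hxmin (subset_closure (mem_iUnion.2 ⟨ε, hwC ε⟩))
    have h2 : infDist (w ε) P ≤ infDist x P / 2 := (hw ε).trans (min_le_right _ _)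
    linarith
  exact hD.iterate_mem hf hKp hxK (fun n hn i => hM n hn _ (hxP.2 i)) hKb hyK n

/-- A continuum on which the iterates are not uniformly bounded contains an unbounded orbit. -/
theorem inter_unboundedOrbitSet_nonempty (hD : IsExpandingExhaustion f D) (hf : Continuous f)
    {Γ : Set ℂ} (hΓ : IsCompact Γ) (hΓc : IsPreconnected Γ) (hb : ¬ HasBoundedIteratesOn f Γ) :
    (Γ ∩ unboundedOrbitSet f).Nonempty := by
  let S := {C : Set ℂ // IsCompact C ∧ IsPreconnected C ∧ ¬ HasBoundedIteratesOn f C}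
  have hstep : ∀ (k : ℕ) (C : S), ∃ C' : S, C'.1 ⊆ C.1 ∧ ∀ z ∈ C'.1, ∃ n : ℕ, k < ‖f^[n] z‖ := by
    rintro k ⟨C, h1, h2, h3⟩
    obtain ⟨C', h, h1', h2', h3', h4⟩ := hD.exists_subset_lt_norm_iterate hf h1 h2 h3 k
    exact ⟨⟨C', h1', h2', h3'⟩, h, h4⟩
  choose next hsub hlt using hstep
  let C : ℕ → S := fun n => Nat.rec ⟨Γ, hΓ, hΓc, hb⟩ next n
  have hne : ∀ n, (C n).1.Nonempty := fun n => by
    by_contra he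
    rw [not_nonempty_iff_eq_empty] at he
    exact (C n).2.2.2 ⟨0, by simp [he]⟩
  obtain ⟨z, hz⟩ := IsCompact.nonempty_iInter_of_sequence_nonempty_isCompact_isClosed
    (fun n => (C n).1) (fun n => hsub n (C n)) hne hΓ (fun n => (C n).2.1.isClosed)
  rw [mem_iInter] at hz
  refine ⟨z, hz 0, ?_⟩
  by_contra h
  obtain ⟨B, hB⟩ := notMem_unboundedOrbitSet_iff.1 h
  obtain ⟨k, hk⟩ := exists_nat_gt B
  obtain ⟨n, hn⟩ := hlt k (C k) z (hz (k + 1))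
  linarith [hB n]

/-- If the orbit of 0 is bounded, iterates cannot be uniformly bounded on a closed ball not
contained in `D M`: the zeroth iterate already leaves `D M`. -/
theorem unboundedOrbitSet_nonempty (hD : IsExpandingExhaustion f D) (hf : Continuous f) :
    (unboundedOrbitSet f).Nonempty := by
  by_contra hne
  obtain ⟨k, hk⟩ := notMem_unboundedOrbitSet_iff.1 fun h : (0 : ℂ) ∈ unboundedOrbitSet f => hne ⟨0, h⟩
  obtain ⟨M, hM⟩ := hD.exists_forall_mem k
  obtain ⟨B, hB⟩ := (hD.isBounded M).exists_norm_le
  have hB' : 0 ≤ |B| + 1 := by positivity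
  obtain ⟨z, -, hz⟩ := hD.inter_unboundedOrbitSet_nonempty hf
    (isCompact_closedBall (0 : ℂ) (|B| + 1)) (convex_closedBall _ _).isPreconnected fun hb => by
      have := hB _ (hD.iterate_mem hf (convex_closedBall (0 : ℂ) (|B| + 1)).isPreconnected
        (mem_closedBall_self hB') (fun n hn i => hM n hn _ (hk i)) hb
        (z := ((|B| + 1 : ℝ) : ℂ)) (by
          rw [mem_closedBall_zero_iff, Complex.norm_real, Real.norm_eq_abs, abs_of_nonneg hB']) 0)
      rw [Function.iterate_zero, id, Complex.norm_real, Real.norm_eq_abs, abs_of_nonneg hB'] at this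
      linarith [le_abs_self B]
  exact hne ⟨z, hz⟩

end IsExpandingExhaustion

/-! ### Maximum principle and connectedness -/

/-- By the maximum principle, a continuum on which the iterates of an entire function are
uniformly bounded does not surround an unbounded orbit. -/
theorem not_isBounded_connectedComponentIn_compl {f : ℂ → ℂ} (hf : Differentiable ℂ f) {K : Set ℂ}
    (hK : IsClosed K) (hb : HasBoundedIteratesOn f K) {a : ℂ} (ha : a ∈ unboundedOrbitSet f) :
    ¬ IsBounded (connectedComponentIn Kᶜ a) := by
  intro hG
  by_cases haK : a ∈ K
  · obtain ⟨B, hB⟩ := hb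
    exact notMem_unboundedOrbitSet_iff.2 ⟨B, hB a haK⟩ ha
  set G := connectedComponentIn Kᶜ a with hGdef
  have hGo : IsOpen G := hK.isOpen_compl.connectedComponentIn
  have hfr : frontier G ⊆ K := fun z hz => by
    by_contra hzK
    rw [hGo.frontier_eq] at hz
    obtain ⟨w, hwz, hwG⟩ := mem_closure_iff.1 hz.1 _ hK.isOpen_compl.connectedComponentIn
      (mem_connectedComponentIn (show z ∈ Kᶜ from hzK))
    apply hz.2
    rw [hGdef, connectedComponentIn_eq hwG, ← connectedComponentIn_eq hwz]
    exact mem_connectedComponentIn hzK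
  obtain ⟨B, hB⟩ := hb
  refine notMem_unboundedOrbitSet_iff.2 ⟨B, fun n => ?_⟩ ha
  exact Complex.norm_le_of_forall_mem_frontier_norm_le hG (hf.iterate n).diffContOnCl
    (fun z hz => hB z (hfr hz) n) (subset_closure (mem_connectedComponentIn haK))

theorem IsExpandingExhaustion.isPreconnected_unboundedOrbitSet {f : ℂ → ℂ} {D : ℕ → Set ℂ}
    (hD : IsExpandingExhaustion f D) (hf : Differentiable ℂ f) :
    IsPreconnected (unboundedOrbitSet f) := by
  intro U₀ V₀ hU₀ hV₀ hI ⟨a, haI, haU₀⟩ ⟨b, hbI, hbV₀⟩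
  by_contra hne
  have hsep : ∀ z ∈ unboundedOrbitSet f, z ∈ U₀ → z ∈ V₀ → False := fun z h1 h2 h3 =>
    hne ⟨z, h1, h2, h3⟩
  -- `U₀` and `V₀` may overlap off the orbit set; complete normality replaces them by disjoint open
  -- sets.
  obtain ⟨U, V, hU, hV, hAU, hBV, hUV⟩ := separatedNhds_iff_disjoint.2
    (completely_normal (s := unboundedOrbitSet f ∩ U₀) (t := unboundedOrbitSet f ∩ V₀)
      (disjoint_left.2 fun z hz hz' => by
        obtain ⟨w, hwV, hwI, hwU⟩ := mem_closure_iff.1 hz _ hV₀ hz'.2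
        exact hsep w hwI hwU hwV)
      (disjoint_left.2 fun z hz hz' => by
        obtain ⟨w, hwU, hwI, hwV⟩ := mem_closure_iff.1 hz' _ hU₀ hz.2
        exact hsep w hwI hwU hwV))
  set F := (U ∪ V)ᶜ with hF
  have hFc : IsClosed F := (hU.union hV).isClosed_compl
  have hFI : ∀ z ∈ F, z ∉ unboundedOrbitSet f := fun z hz hzI => by
    rcases hI hzI with h | h
    · exact hz (Or.inl (hAU ⟨hzI, h⟩))
    · exact hz (Or.inr (hBV ⟨hzI, h⟩))
  -- Requiring `Q` to be relatively clopen in `F` allows finitely many pieces to be made disjoint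
  -- and their logarithms glued.
  let p : Set ℂ → Prop := fun s => ∃ Q, IsCompact Q ∧ Q ⊆ F ∧ IsClosed (F \ Q) ∧ s ⊆ Q ∧
    HasLogOn (fun z => z - a) Q ∧ HasLogOn (fun z => z - b) Q
  have hloc : ∀ x ∈ F, ∃ W, IsOpen W ∧ x ∈ W ∧ p (F ∩ W) := by
    intro x hx
    obtain ⟨k, hk⟩ := notMem_unboundedOrbitSet_iff.1 (hFI x hx)
    obtain ⟨M, hM⟩ := hD.exists_forall_mem k
    obtain ⟨R, hR⟩ := (hD.isBounded M).subset_ball (0 : ℂ)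
    have hK : IsCompact (F ∩ closedBall 0 R) := (isCompact_closedBall 0 R).inter_left hFc
    have hxR : x ∈ F ∩ closedBall 0 R :=
      ⟨hx, ball_subset_closedBall (hR (hM M le_rfl x (by simpa using hk 0)))⟩
    set C := connectedComponentIn (F ∩ closedBall 0 R) x
    have hC : IsCompact C := isCompact_connectedComponentIn hK x
    have hCp : IsPreconnected C := isPreconnected_connectedComponentIn
    have hCF : C ⊆ F := fun z hz => (connectedComponentIn_subset _ _ hz).1
    have hCb : HasBoundedIteratesOn f C := by
      by_contra h
      obtain ⟨z, hzC, hzI⟩ := hD.inter_unboundedOrbitSet_nonempty hf.continuous hC hCp h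
      exact hFI z (hCF hzC) hzI
    -- Staying off the bounding sphere makes the piece cut out around `C` clopen in `F` itself, not
    -- only in `F ∩ closedBall 0 R`.
    have hCR : C ⊆ ball 0 R := fun z hz => hR (hD.iterate_mem hf.continuous hCp
      (mem_connectedComponentIn hxR) (fun n hn i => hM n hn _ (hk i)) hCb hz 0)
    have hlog : ∀ c ∈ unboundedOrbitSet f, HasLogOn (fun z => z - c) C := fun c hc =>
      hasLogOn_sub_of_not_isBounded hC
        (not_isBounded_connectedComponentIn_compl hf hC.isClosed hCb hc)
    obtain ⟨O₁, hO₁, hCO₁, hl₁⟩ := (hlog a haI).exists_isOpen_superset (by fun_prop) hC.isClosed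
    obtain ⟨O₂, hO₂, hCO₂, hl₂⟩ := (hlog b hbI).exists_isOpen_superset (by fun_prop) hC.isClosed
    obtain ⟨W, hW, hxW, hQ, hQO⟩ := exists_isCompact_inter_open_of_connectedComponentIn_subset hK
      hxR ((hO₁.inter hO₂).inter isOpen_ball) (subset_inter (subset_inter hCO₁ hCO₂) hCR)
    have hQF : F ∩ closedBall 0 R ∩ W = F ∩ (W ∩ ball 0 R) := by
      ext z
      constructor
      · exact fun hz => ⟨hz.1.1, hz.2, (hQO hz).2⟩
      · exact fun hz => ⟨⟨hz.1, ball_subset_closedBall hz.2.2⟩, hz.2.1⟩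
    rw [hQF] at hQ hQO
    refine ⟨W ∩ ball 0 R, hW.inter isOpen_ball, ⟨hxW, hCR (mem_connectedComponentIn hxR)⟩,
      F ∩ (W ∩ ball 0 R), hQ, inter_subset_left, ?_, subset_rfl,
      hl₁.mono fun z hz => (hQO hz).1.1, hl₂.mono fun z hz => (hQO hz).1.2⟩
    rw [sdiff_self_inter]
    exact hFc.sdiff (hW.inter isOpen_ball)
  -- For `‖z‖ ≥ r` this gives `‖b - a‖ < ‖z - b‖`, so the quotient lies in the slit plane.
  set r := ‖a‖ + 2 * ‖b‖ + 1 with hr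
  obtain ⟨Q, hQ, hQF, hFQ, hrQ, hla, hlb⟩ : p (F ∩ closedBall 0 r) := by
    refine ((isCompact_closedBall 0 r).inter_left hFc).induction_on ?_ ?_ ?_ ?_
    · exact ⟨∅, isCompact_empty, empty_subset _, by simpa using hFc, subset_rfl,
        ⟨0, continuousOn_empty _, by simp⟩, ⟨0, continuousOn_empty _, by simp⟩⟩
    · rintro s t hst ⟨Q, h1, h2, h3, h4, h5⟩
      exact ⟨Q, h1, h2, h3, hst.trans h4, h5⟩
    · rintro s t ⟨Q, h1, h2, h3, h4, h5, h6⟩ ⟨Q', h1', h2', h3', h4', h5', h6'⟩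
      have hQ' : Q' \ Q = Q' ∩ (F \ Q) := by
        ext z
        exact ⟨fun hz => ⟨hz.1, h2' hz.1, hz.2⟩, fun hz => ⟨hz.1, hz.2.2⟩⟩
      have hc : IsClosed (Q' \ Q) := by rw [hQ']; exact h1'.isClosed.inter h3
      refine ⟨Q ∪ Q', h1.union h1', union_subset h2 h2', ?_, union_subset_union h4 h4', ?_, ?_⟩
      · rw [← sdiff_inter_sdiff]
        exact h3.inter h3'
      · rw [← union_sdiff_self]
        exact h5.union (h5'.mono sdiff_subset) h1.isClosed hc disjoint_sdiff_right
      · rw [← union_sdiff_self]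
        exact h6.union (h6'.mono sdiff_subset) h1.isClosed hc disjoint_sdiff_right
    · intro x hx
      obtain ⟨W, hW, hxW, Q, h1, h2, h3, h4, h5⟩ := hloc x hx.1
      exact ⟨F ∩ closedBall 0 r ∩ W, inter_mem self_mem_nhdsWithin
        (mem_nhdsWithin_of_mem_nhds (hW.mem_nhds hxW)), Q, h1, h2, h3,
        (inter_subset_inter_left W inter_subset_left).trans h4, h5⟩
  obtain ⟨R₀, hR₀⟩ := hQ.isBounded.subset_ball (0 : ℂ)
  set R := max R₀ r
  have hQR : Q ⊆ ball 0 R := hR₀.trans (ball_subset_ball (le_max_left _ _))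
  have hE : IsClosed ((F \ Q) ∪ (ball (0 : ℂ) R)ᶜ) := hFQ.union isOpen_ball.isClosed_compl
  have hfar : ∀ z ∈ (F \ Q) ∪ (ball (0 : ℂ) R)ᶜ, r ≤ ‖z‖ := by
    rintro z (hz | hz)
    · by_contra h
      exact hz.2 (hrQ ⟨hz.1, by simpa using (not_le.1 h).le⟩)
    · have : R ≤ ‖z‖ := by simpa using hz
      exact (le_max_right _ _).trans this
  refine not_hasLogOn_div_of_separated hU hV hUV (hAU ⟨haI, haU₀⟩) (hBV ⟨hbI, hbV₀⟩)
    (hQ.isClosed.union hE) (R := R) ?_ (fun z hz => Or.inr (Or.inr hz))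
    ((hla.div hlb).union ?_ hQ.isClosed hE ?_)
  · intro z hz
    by_cases hzQ : z ∈ Q
    · exact Or.inl hzQ
    · exact Or.inr (Or.inl ⟨hz, hzQ⟩)
  · have hlt : ∀ z ∈ (F \ Q) ∪ (ball (0 : ℂ) R)ᶜ, ‖(z - a) - (z - b)‖ < ‖z - b‖ := fun z hz => by
      have h1 := hfar z hz
      have h2 := norm_sub_norm_le z b
      have h3 := norm_sub_le b a
      rw [sub_sub_sub_cancel_left]
      linarith [norm_nonneg a, norm_nonneg b]
    have hne : ∀ z ∈ (F \ Q) ∪ (ball (0 : ℂ) R)ᶜ, z - b ≠ 0 := fun z hz =>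
      norm_pos_iff.1 ((norm_nonneg _).trans_lt (hlt z hz))
    have hs := fun z hz => div_mem_slitPlane_of_norm_sub_lt (hlt z hz)
    exact ⟨fun z => Complex.log ((z - a) / (z - b)),
      (ContinuousOn.div (by fun_prop) (by fun_prop) hne).clog hs,
      fun z hz => Complex.exp_log (Complex.slitPlane_ne_zero (hs z hz))⟩
  · refine disjoint_left.2 fun z hz => ?_
    rintro (h | h)
    · exact h.2 hz
    · exact h (hQR hz)

theorem theorem3p1 (f : ℂ → ℂ) (hf : IsTranscendentalEntire f) (D : ℕ → Set ℂ)
    (hopen : ∀ n : ℕ, IsOpen (D n))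
    (hsc : ∀ n : ℕ, IsSimplyConnected (D n))
    (hbdd : ∀ n : ℕ, Bornology.IsBounded (D n))
    (hsurr : ∀ n : ℕ, Surrounds (f '' frontier (D n)) (D (n + 1)))
    (hdisc : ∀ r : ℝ, 0 < r → ∃ N : ℕ, ∀ n : ℕ, N ≤ n → Metric.ball (0 : ℂ) r ⊆ D n) :
    IsConnected (unboundedOrbitSet f) := by
  have hD : IsExpandingExhaustion f D := by
    refine ⟨hopen, hbdd, fun n => ?_, hdisc⟩
    obtain ⟨w, -, -, hw⟩ := hsurr n
    exact disjoint_left.2 fun z hz hzD => connectedComponentIn_subset _ _ (hw hzD) hz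
  exact ⟨hD.unboundedOrbitSet_nonempty hf.1.continuous, hD.isPreconnected_unboundedOrbitSet hf.1⟩
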